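/- Theorem (Prime Number Theorem). For real $x$ let $\pi(x)$ denote the number of primes $p\le x$, and for $n\ge 1$ let $p_n$ denote the $n$-th prime (so $p_1=2$, $p_2=3,\dots$). Then $$\pi(x)\sim\frac{x}{\log x}\quad (x\to\infty,\ x\in\mathbb{R})\qquad\text{and}\qquad p_n\sim n\log n\quad (n\to\infty,\ n\in\mathbb{N}),$$ where $\log$ is the natural logarithm and $f\sim g$ means that $f/g\to 1$. -/

import Mathlib

open Filter Asymptotics

/-!
The prime number theorem is deduced from a Tauberian theorem of Wiener–Ikehara type, applied to
`H u = ψ(e^u) e^{-u}`, where `ψ` is Chebyshev's function.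

By partial summation the Laplace transform of `H - 1` at `s` is `(A (s + 1) - 1) / (s + 1)`, where
`A s = -ζ'(s) / ζ(s) - 1 / (s - 1)`. Since `ζ` has no zero on the line `re s = 1` and its pole at
`1` is simple, `A` is continuous on `1 ≤ re s`; this is in Mathlib, as the case of modulus `1` of
the function used for Dirichlet's theorem. Chebyshev's estimate gives that `H` is bounded.

For the Tauberian theorem, pair the Laplace transform on the line `re s = ε` with the triangle
function on `[-a, a]`. By Fubini's theorem this is the mean of `(H u - 1) e^{-εu}` against a Fejér
kernel centred at `y`; both sides have limits as `ε → 0`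
(`PrimeNumberTheorem.integral_boundary_mul_fejer`). The pairing then involves only the boundary
values on a compact segment, so by the Riemann–Lebesgue lemma it tends to `0` as `y → ∞`
(`PrimeNumberTheorem.tendsto_integral_mul_fejer`), without any bound on the growth of `ζ' / ζ` along
the line. Hence every Fejér mean of `H` tends to the mass of the kernel. As the kernel is
nonnegative and `e^u H u` is monotone, concentrating the kernel gives `H u → 1`
(`PrimeNumberTheorem.tendsto_of_tendsto_integral_mul_sinc_sq`), that is `ψ x ~ x`.

The passage from `ψ` to `θ` and to `π` uses `ψ x - θ x = O(√x)` and
`π x - θ x / log x = O(x / log² x)`, both in Mathlib. For `p` the `n`-th prime, `π p = n` gives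
`n ~ p / log p`, hence `log n ~ log p` and `n log n ~ p`.
-/

namespace PrimeNumberTheorem

open MeasureTheory Set Topology

/-! ### The Fejér kernel -/

lemma integral_sub_mul_two_cos (v : ℝ) (hv : v ≠ 0) (a : ℝ) :
    ∫ t in (0 : ℝ)..a, (a - t) * (2 * Real.cos (t * v)) = 2 * (1 - Real.cos (a * v)) / v ^ 2 := by
  have hd (t : ℝ) : HasDerivAt
      (fun t ↦ 2 * ((a - t) * Real.sin (t * v) / v - Real.cos (t * v) / v ^ 2))
      ((a - t) * (2 * Real.cos (t * v))) t := by
    have h1 : HasDerivAt (fun t : ℝ ↦ t * v) v t := by simpa using (hasDerivAt_id t).mul_const v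
    have h2 : HasDerivAt (fun t : ℝ ↦ a - t) (-1) t := by simpa using (hasDerivAt_id t).const_sub a
    convert! (((h2.mul h1.sin).div_const v).sub (h1.cos.div_const (v ^ 2))).const_mul 2 using 1
    field_simp
    ring
  rw [intervalIntegral.integral_eq_sub_of_hasDerivAt (fun t _ ↦ hd t)
    (by apply Continuous.intervalIntegrable; fun_prop)]
  simp
  field_simp
  ring

/-- The Fourier transform of the triangle function `t ↦ a - |t|` on `[-a, a]` is the Fejér kernel
`(a sinc (a v / 2))²`. The point `v = 0`, a null set for every later purpose, is left out. -/
lemma integral_fejer {a : ℝ} (ha : 0 ≤ a) {v : ℝ} (hv : v ≠ 0) :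
    ∫ t in Ioc (-a) a, ((a - |t| : ℝ) : ℂ) * Complex.exp (t * v * Complex.I) =
      (((a * Real.sinc (a * v / 2)) ^ 2 : ℝ) : ℂ) := by
  rw [← intervalIntegral.integral_of_le (by linarith)]
  have hc : Continuous fun t : ℝ ↦ ((a - |t| : ℝ) : ℂ) * Complex.exp (t * v * Complex.I) := by
    fun_prop
  have hc' : Continuous fun t : ℝ ↦
      ((a - |(-t)| : ℝ) : ℂ) * Complex.exp ((-t : ℝ) * v * Complex.I) := by
    fun_prop
  rw [← intervalIntegral.integral_add_adjacent_intervals (b := 0) (hc.intervalIntegrable _ _)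
    (hc.intervalIntegrable _ _)]
  -- Folding `t < 0` onto `t > 0` replaces the exponential by `2 cos (t v)`.
  have hneg := intervalIntegral.integral_comp_neg (a := 0) (b := a)
    (fun t : ℝ ↦ ((a - |t| : ℝ) : ℂ) * Complex.exp (t * v * Complex.I))
  rw [neg_zero] at hneg
  rw [← hneg, ← intervalIntegral.integral_add
    (hc'.intervalIntegrable _ _) (hc.intervalIntegrable _ _)]
  have : ∀ t ∈ uIcc 0 a, ((a - |(-t)| : ℝ) : ℂ) * Complex.exp ((-t : ℝ) * v * Complex.I) +
      ((a - |t| : ℝ) : ℂ) * Complex.exp (t * v * Complex.I) =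
      (((a - t) * (2 * Real.cos (t * v)) : ℝ) : ℂ) := by
    intro t ht
    rw [uIcc_of_le ha] at ht
    rw [abs_neg, abs_of_nonneg ht.1, ← mul_add]
    push_cast
    rw [Complex.two_cos]
    ring_nf
  rw [intervalIntegral.integral_congr this, intervalIntegral.integral_ofReal,
    integral_sub_mul_two_cos v hv]
  congr 1
  rcases ha.eq_or_lt with rfl | ha
  · simp
  rw [Real.sinc_of_ne_zero (by positivity), show a * v = 2 * (a * v / 2) by ring,
    Real.cos_two_mul, show 2 * (a * v / 2) / 2 = a * v / 2 by ring, Real.cos_sq']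
  field_simp
  ring

lemma sinc_sq_le (x : ℝ) : Real.sinc x ^ 2 ≤ 2 * (1 + x ^ 2)⁻¹ := by
  rw [← div_eq_mul_inv, le_div_iff₀ (by positivity)]
  have h1 : Real.sinc x ^ 2 ≤ 1 := by
    rw [sq_le_one_iff_abs_le_one]; exact Real.abs_sinc_le_one x
  have h2 : Real.sinc x ^ 2 * x ^ 2 ≤ 1 := by
    rcases eq_or_ne x 0 with rfl | hx
    · simp
    · rw [Real.sinc_of_ne_zero hx, div_pow, div_mul_cancel₀ _ (by positivity)]
      exact Real.sin_sq_le_one x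
  linarith

lemma integrable_sinc_sq : Integrable fun x : ℝ ↦ Real.sinc x ^ 2 := by
  refine (integrable_inv_one_add_sq.const_mul 2).mono'
    (Real.continuous_sinc.pow 2).aestronglyMeasurable (ae_of_all _ fun x ↦ ?_)
  rw [Real.norm_of_nonneg (sq_nonneg _)]
  exact sinc_sq_le x

lemma integral_sinc_sq_pos : 0 < ∫ x : ℝ, Real.sinc x ^ 2 :=
  integral_pos_of_integrable_nonneg_nonzero (x := 0) (Real.continuous_sinc.pow 2)
    integrable_sinc_sq (fun _ ↦ sq_nonneg _) (by simp)

lemma integrable_fejer {a : ℝ} (ha : 0 < a) (y : ℝ) :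
    Integrable fun u : ℝ ↦ (a * Real.sinc (a * (y - u) / 2)) ^ 2 := by
  have h := ((integrable_sinc_sq.comp_mul_left' (R := a / 2) (by positivity)).comp_sub_left
    y).const_mul (a ^ 2)
  refine h.congr (ae_of_all _ fun u ↦ ?_)
  simp only [mul_pow]
  ring_nf

/-! ### Fejér means of a bounded function from its Laplace transform -/

/-- The Riemann–Lebesgue lemma in the normalisation `e^{ity}` without the factor `-2π`. -/
lemma tendsto_integral_exp_mul_atTop (f : ℝ → ℂ) :
    Tendsto (fun y : ℝ ↦ ∫ t, f t * Complex.exp (t * y * Complex.I)) atTop (𝓝 0) := by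
  have h : Tendsto (fun y : ℝ ↦ y * -(2 * Real.pi)⁻¹) atTop (cocompact ℝ) :=
    (tendsto_id.atTop_mul_const_of_neg (by simp [Real.pi_pos])).mono_right atBot_le_cocompact
  refine ((Real.tendsto_integral_exp_smul_cocompact f).comp h).congr fun y ↦ ?_
  refine integral_congr_ae (ae_of_all _ fun t ↦ ?_)
  simp only [Real.fourierChar, Circle.smul_def, smul_eq_mul]
  rw [mul_comm]
  congr 1
  change Complex.exp _ = _
  congr 1
  push_cast
  field_simp

/-- Parseval's identity on the line `re s = ε`: pairing the Laplace transform `G` of `B` with the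
triangle function equals pairing `B u * e^{-εu}` with the Fejér kernel. The factor `e^{-εu}` makes
the double integral absolutely convergent, so this is Fubini's theorem. -/
theorem integral_laplace_mul_fejer {B : ℝ → ℝ} {C : ℝ} (hBm : Measurable B) (hBC : ∀ u, |B u| ≤ C)
    {G : ℂ → ℂ}
    (hG : ∀ s : ℂ, 0 < s.re → ∫ u in Ioi (0 : ℝ), (B u : ℂ) * Complex.exp (-s * u) = G s)
    {a : ℝ} (ha : 0 ≤ a) (y : ℝ) {ε : ℝ} (hε : 0 < ε) :
    ∫ t in Ioc (-a) a, ((a - |t| : ℝ) : ℂ) * G (ε + t * Complex.I) *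
        Complex.exp (t * y * Complex.I) =
      ∫ u in Ioi (0 : ℝ), ((B u * Real.exp (-ε * u) *
        (a * Real.sinc (a * (y - u) / 2)) ^ 2 : ℝ) : ℂ) := by
  let f : ℝ → ℝ → ℂ := fun t u ↦ ((a - |t| : ℝ) : ℂ) * ((B u : ℂ) *
    Complex.exp (-(ε + t * Complex.I) * u)) * Complex.exp (t * y * Complex.I)
  have hint : Integrable (Function.uncurry f)
      ((volume.restrict (Ioc (-a) a)).prod (volume.restrict (Ioi 0))) := by
    have h1 : Integrable (fun p : ℝ × ℝ ↦ a * (C * Real.exp (-ε * p.2)))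
        ((volume.restrict (Ioc (-a) a)).prod (volume.restrict (Ioi 0))) :=
      Integrable.mul_prod (f := fun _ ↦ a) (g := fun u ↦ C * Real.exp (-ε * u))
        (integrable_const a) ((integrableOn_exp_mul_Ioi (neg_lt_zero.mpr hε) 0).const_mul C)
    refine h1.mono' (Measurable.aestronglyMeasurable ?_) ?_
    · simp only [f, Function.uncurry_def]
      fun_prop
    · rw [Measure.prod_restrict]
      refine (ae_restrict_mem (measurableSet_Ioc.prod measurableSet_Ioi)).mono ?_
      rintro ⟨t, u⟩ ⟨ht, hu⟩
      simp only [Function.uncurry_apply_pair, f, norm_mul, Complex.norm_real, Complex.norm_exp]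
      have e1 : (t * y * Complex.I : ℂ).re = 0 := by simp
      have e2 : (-(ε + t * Complex.I) * u : ℂ).re = -ε * u := by simp
      rw [e1, e2, Real.exp_zero, mul_one, Real.norm_eq_abs, Real.norm_eq_abs]
      have : abs (a - |t|) ≤ a := by
        rw [abs_of_nonneg (sub_nonneg.mpr (abs_le.mpr ⟨ht.1.le, ht.2⟩))]
        linarith [abs_nonneg t]
      gcongr
      exact hBC u
  have hswap := integral_integral_swap hint
  have hl : ∫ t in Ioc (-a) a, ((a - |t| : ℝ) : ℂ) * G (ε + t * Complex.I) *
        Complex.exp (t * y * Complex.I) = ∫ t in Ioc (-a) a, ∫ u in Ioi (0 : ℝ), f t u := by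
    refine integral_congr_ae (ae_of_all _ fun t ↦ ?_)
    simp only [f]
    rw [integral_mul_const, integral_const_mul, hG _ (by simpa using hε)]
  rw [hl, hswap]
  refine integral_congr_ae ?_
  -- The closed form of the kernel is only available for `u ≠ y`.
  filter_upwards [(Measure.ae_ne (volume.restrict (Ioi (0 : ℝ))) y)] with u hu
  have hu' : y - u ≠ 0 := sub_ne_zero.mpr (Ne.symm hu)
  rw [Complex.ofReal_mul, ← integral_fejer ha hu', ← integral_const_mul]
  refine integral_congr_ae (ae_of_all _ fun t ↦ ?_)
  simp only [f]
  have : Complex.exp (-(ε + t * Complex.I) * u) * Complex.exp (t * y * Complex.I) =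
      Complex.exp (-ε * u) * Complex.exp (t * (y - u : ℝ) * Complex.I) := by
    rw [← Complex.exp_add, ← Complex.exp_add]
    congr 1
    push_cast
    ring
  push_cast at this ⊢
  linear_combination (a - |t| : ℂ) * B u * this

/-- The limit `ε → 0` of `integral_laplace_mul_fejer`. On the transform side `G` is bounded near the
segment `[-ia, ia]` by continuity up to the boundary; on the other side the Fejér kernel is
integrable and `B` is bounded. -/
theorem integral_boundary_mul_fejer {B : ℝ → ℝ} {C : ℝ} (hBm : Measurable B)
    (hBC : ∀ u, |B u| ≤ C) {G : ℂ → ℂ} (hGc : ContinuousOn G {s | 0 ≤ s.re})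
    (hG : ∀ s : ℂ, 0 < s.re → ∫ u in Ioi (0 : ℝ), (B u : ℂ) * Complex.exp (-s * u) = G s)
    {a : ℝ} (ha : 0 < a) (y : ℝ) :
    ∫ t in Ioc (-a) a, ((a - |t| : ℝ) : ℂ) * G (t * Complex.I) *
        Complex.exp (t * y * Complex.I) =
      ∫ u in Ioi (0 : ℝ), ((B u * (a * Real.sinc (a * (y - u) / 2)) ^ 2 : ℝ) : ℂ) := by
  have hC : 0 ≤ C := (abs_nonneg _).trans (hBC 0)
  have hGc' : ContinuousOn (fun p : ℝ × ℝ ↦ G (p.1 + p.2 * Complex.I)) {p | 0 ≤ p.1} :=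
    hGc.comp (by fun_prop) fun p hp ↦ by simpa using hp
  obtain ⟨M, hM⟩ := ((isCompact_Icc (a := (0 : ℝ)) (b := 1)).prod
    (isCompact_Icc (a := -a) (b := a))).exists_bound_of_continuousOn
    (hGc'.mono fun p hp ↦ hp.1.1)
  have hsmall : ∀ᶠ ε : ℝ in 𝓝[>] 0, ε ∈ Ioc (0 : ℝ) 1 := Ioc_mem_nhdsGT one_pos
  have h1 : Tendsto (fun ε : ℝ ↦ ∫ t in Ioc (-a) a, ((a - |t| : ℝ) : ℂ) *
      G (ε + t * Complex.I) * Complex.exp (t * y * Complex.I)) (𝓝[>] 0)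
      (𝓝 (∫ t in Ioc (-a) a, ((a - |t| : ℝ) : ℂ) * G (t * Complex.I) *
        Complex.exp (t * y * Complex.I))) := by
    refine tendsto_integral_filter_of_dominated_convergence (fun _ ↦ a * M) ?_ ?_
      (integrable_const _) ?_
    · filter_upwards [hsmall] with ε hε
      refine Continuous.aestronglyMeasurable ?_
      have : Continuous fun t : ℝ ↦ G (ε + t * Complex.I) :=
        hGc.comp_continuous (by fun_prop) fun t ↦ by simpa using hε.1.le
      exact (Continuous.mul (by fun_prop) this).mul (by fun_prop)
    · filter_upwards [hsmall] with ε hε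
      filter_upwards [ae_restrict_mem measurableSet_Ioc] with t ht
      have e1 : (t * y * Complex.I : ℂ).re = 0 := by simp
      rw [norm_mul, norm_mul, Complex.norm_exp, e1, Real.exp_zero, mul_one, Complex.norm_real,
        Real.norm_of_nonneg (sub_nonneg.mpr (abs_le.mpr ⟨ht.1.le, ht.2⟩))]
      gcongr
      · linarith [abs_nonneg t]
      · exact hM (ε, t) ⟨⟨hε.1.le, hε.2⟩, ht.1.le, ht.2⟩
    · refine ae_of_all _ fun t ↦ ?_
      refine (Tendsto.const_mul _ ?_).mul_const _
      have := (hGc' (0, t) (by simp)).tendsto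
      simp only [Complex.ofReal_zero, zero_add] at this
      refine this.comp (f := fun ε : ℝ ↦ (ε, t)) (tendsto_nhdsWithin_iff.mpr ⟨?_, ?_⟩)
      · exact (Continuous.tendsto' (by fun_prop) _ _ rfl).mono_left nhdsWithin_le_nhds
      · filter_upwards [hsmall] with ε hε using hε.1.le
  have h2 : Tendsto (fun ε : ℝ ↦ ∫ u in Ioi (0 : ℝ), ((B u * Real.exp (-ε * u) *
        (a * Real.sinc (a * (y - u) / 2)) ^ 2 : ℝ) : ℂ)) (𝓝[>] 0)
      (𝓝 (∫ u in Ioi (0 : ℝ), ((B u * (a * Real.sinc (a * (y - u) / 2)) ^ 2 : ℝ) : ℂ))) := by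
    refine tendsto_integral_filter_of_dominated_convergence
      (fun u ↦ C * (a * Real.sinc (a * (y - u) / 2)) ^ 2) ?_ ?_
      ((integrable_fejer ha y).integrableOn.const_mul C) ?_
    · refine Eventually.of_forall fun ε ↦ Measurable.aestronglyMeasurable ?_
      have := Real.continuous_sinc.measurable
      fun_prop
    · filter_upwards [hsmall] with ε hε
      filter_upwards [ae_restrict_mem measurableSet_Ioi] with u hu
      rw [Complex.norm_real, norm_mul, norm_mul, Real.norm_of_nonneg (sq_nonneg _),
        Real.norm_of_nonneg (Real.exp_nonneg _), Real.norm_eq_abs]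
      gcongr
      have : Real.exp (-ε * u) ≤ 1 := by
        rw [Real.exp_le_one_iff]
        have := mul_nonneg hε.1.le (mem_Ioi.mp hu).le
        linarith
      simpa using mul_le_mul (hBC u) this (Real.exp_nonneg _) hC
    · refine ae_of_all _ fun u ↦ ?_
      refine (Continuous.tendsto' (by fun_prop) _ _ (by simp)).mono_left nhdsWithin_le_nhds
  refine tendsto_nhds_unique h1 (h2.congr' ?_)
  filter_upwards [hsmall] with ε hε
  exact (integral_laplace_mul_fejer hBm hBC hG ha.le y hε.1).symm

/-- The Fejér means of `B` tend to `0`: by `integral_boundary_mul_fejer` they are the Fourier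
transform of a function supported in `[-a, a]`. -/
theorem tendsto_integral_mul_fejer {B : ℝ → ℝ} {C : ℝ} (hBm : Measurable B)
    (hBC : ∀ u, |B u| ≤ C) {G : ℂ → ℂ} (hGc : ContinuousOn G {s | 0 ≤ s.re})
    (hG : ∀ s : ℂ, 0 < s.re → ∫ u in Ioi (0 : ℝ), (B u : ℂ) * Complex.exp (-s * u) = G s)
    {a : ℝ} (ha : 0 < a) :
    Tendsto (fun y : ℝ ↦ ∫ u in Ioi (0 : ℝ), B u * (a * Real.sinc (a * (y - u) / 2)) ^ 2)
      atTop (𝓝 0) := by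
  have h := tendsto_integral_exp_mul_atTop
    ((Ioc (-a) a).indicator fun t : ℝ ↦ ((a - |t| : ℝ) : ℂ) * G (t * Complex.I))
  rw [← tendsto_ofReal_iff, Complex.ofReal_zero]
  refine h.congr fun y ↦ ?_
  rw [← integral_complex_ofReal, ← integral_boundary_mul_fejer hBm hBC hGc hG ha y,
    ← integral_indicator measurableSet_Ioc]
  exact integral_congr_ae (ae_of_all _ fun t ↦ (indicator_mul_left (Ioc (-a) a)
    (fun t : ℝ ↦ ((a - |t| : ℝ) : ℂ) * G (t * Complex.I))
    (fun t : ℝ ↦ Complex.exp (t * y * Complex.I))).symm)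

/-! ### The Tauberian theorem -/

/-- Substituting `u = y - b x` turns the Fejér kernel with `a = 2 / b` into `sinc²`. -/
lemma integral_mul_fejer_eq (f : ℝ → ℝ) {b : ℝ} (hb : 0 < b) (y : ℝ) :
    ∫ u, f u * (2 / b * Real.sinc (2 / b * (y - u) / 2)) ^ 2 =
      4 / b * ∫ x, f (y - b * x) * Real.sinc x ^ 2 := by
  have h1 := integral_sub_left_eq_self
    (fun u ↦ f u * (2 / b * Real.sinc (2 / b * (y - u) / 2)) ^ 2) volume y
  have h2 := Measure.integral_comp_mul_left (fun z ↦
    f (y - z) * (2 / b * Real.sinc (2 / b * (y - (y - z)) / 2)) ^ 2) b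
  rw [h1, abs_of_pos (inv_pos.mpr hb), smul_eq_mul, eq_inv_mul_iff_mul_eq₀ hb.ne'] at h2
  rw [← h2, ← integral_const_mul, ← integral_const_mul]
  refine integral_congr_ae (ae_of_all _ fun x ↦ ?_)
  have : 2 / b * (y - (y - b * x)) / 2 = x := by field_simp; ring
  simp only [this]
  field_simp
  ring

lemma integrable_comp_mul_sinc_sq {f : ℝ → ℝ} {C : ℝ} (hf : Measurable f) (hC : ∀ u, |f u| ≤ C)
    (y b : ℝ) : Integrable fun x ↦ f (y - b * x) * Real.sinc x ^ 2 := by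
  refine (integrable_sinc_sq.const_mul C).mono' (Measurable.aestronglyMeasurable ?_)
    (ae_of_all _ fun x ↦ ?_)
  · have := Real.continuous_sinc.measurable
    fun_prop
  · rw [norm_mul, Real.norm_of_nonneg (sq_nonneg (Real.sinc x))]
    gcongr
    exact hC _

/-- A bounded nonnegative `H` with `u ↦ e^u H u` monotone tends to `1` if all its means against
rescaled kernels `sinc²` tend to the total mass of `sinc²`. Monotonicity compares `H y` with the
values of `H` on a short interval next to `y`, where almost all of the mass of a narrow kernel
sits. -/
theorem tendsto_of_tendsto_integral_mul_sinc_sq {H : ℝ → ℝ} {C : ℝ} (hHm : Measurable H)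
    (hH0 : ∀ u, 0 ≤ H u) (hHC : ∀ u, H u ≤ C)
    (hmono : ∀ u v, u ≤ v → H u ≤ H v * Real.exp (v - u))
    (hlim : ∀ b > 0, Tendsto (fun y ↦ ∫ x, H (y - b * x) * Real.sinc x ^ 2) atTop
      (𝓝 (∫ x, Real.sinc x ^ 2))) :
    Tendsto H atTop (𝓝 1) := by
  set I := ∫ x : ℝ, Real.sinc x ^ 2 with hI
  have hIpos : 0 < I := integral_sinc_sq_pos
  let J : ℝ → ℝ := fun a ↦ ∫ x in Icc (-a) a, Real.sinc x ^ 2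
  have hJ : Tendsto J atTop (𝓝 I) :=
    (aecover_Icc tendsto_neg_atTop_atBot tendsto_id).integral_tendsto_of_countably_generated
      integrable_sinc_sq
  have hint (y b : ℝ) : Integrable fun x ↦ H (y - b * x) * Real.sinc x ^ 2 :=
    integrable_comp_mul_sinc_sq hHm (fun u ↦ (abs_of_nonneg (hH0 u)).trans_le (hHC u)) y b
  -- At scale `b = a⁻²` the points `b x` with `|x| ≤ a` stay within `1 / a` of `0`. Centring the
  -- kernel at `y ± 1 / a` then puts this part of the mass on one side of `y`.
  have hshift {a x : ℝ} (ha : 0 < a) (hx : x ∈ Icc (-a) a) : |(a ^ 2)⁻¹ * x| ≤ 1 / a := by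
    rw [abs_mul, abs_of_pos (by positivity), inv_mul_le_iff₀ (by positivity)]
    calc |x| ≤ a := abs_le.mpr hx
      _ = a ^ 2 * (1 / a) := by field_simp
  have hup {a : ℝ} (ha : 0 < a) (y : ℝ) : Real.exp (-(2 / a)) * J a * H y ≤
      ∫ x, H (y + 1 / a - (a ^ 2)⁻¹ * x) * Real.sinc x ^ 2 := by
    calc Real.exp (-(2 / a)) * J a * H y
        = ∫ x in Icc (-a) a, (H y * Real.exp (-(2 / a))) * Real.sinc x ^ 2 := by
          rw [integral_const_mul]; ring
      _ ≤ ∫ x in Icc (-a) a, H (y + 1 / a - (a ^ 2)⁻¹ * x) * Real.sinc x ^ 2 := by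
          refine setIntegral_mono_on (integrable_sinc_sq.const_mul _).integrableOn
            (hint _ _).integrableOn measurableSet_Icc fun x hx ↦ ?_
          have h := abs_le.mp (hshift ha hx)
          refine mul_le_mul_of_nonneg_right ?_ (sq_nonneg _)
          rw [Real.exp_neg, ← div_eq_mul_inv, div_le_iff₀ (Real.exp_pos _)]
          refine (hmono y (y + 1 / a - (a ^ 2)⁻¹ * x) (by linarith)).trans ?_
          gcongr
          · exact hH0 _
          · have : 2 / a = 1 / a + 1 / a := by ring
            linarith
      _ ≤ _ := setIntegral_le_integral (hint _ _)
          (ae_of_all _ fun x ↦ mul_nonneg (hH0 _) (sq_nonneg _))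
  have hlow {a : ℝ} (ha : 0 < a) (y : ℝ) :
      ∫ x, H (y - 1 / a - (a ^ 2)⁻¹ * x) * Real.sinc x ^ 2 ≤
        H y * (Real.exp (2 / a) * I) + C * (I - J a) := by
    rw [← integral_add_compl (measurableSet_Icc (a := -a) (b := a)) (hint _ _)]
    refine add_le_add ?_ ?_
    · calc ∫ x in Icc (-a) a, H (y - 1 / a - (a ^ 2)⁻¹ * x) * Real.sinc x ^ 2
          ≤ ∫ x in Icc (-a) a, (H y * Real.exp (2 / a)) * Real.sinc x ^ 2 := by
            refine setIntegral_mono_on (hint _ _).integrableOn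
              (integrable_sinc_sq.const_mul _).integrableOn measurableSet_Icc fun x hx ↦ ?_
            have h := abs_le.mp (hshift ha hx)
            refine mul_le_mul_of_nonneg_right ?_ (sq_nonneg _)
            refine (hmono (y - 1 / a - (a ^ 2)⁻¹ * x) y (by linarith)).trans ?_
            gcongr
            · exact hH0 _
            · have : 2 / a = 1 / a + 1 / a := by ring
              linarith
        _ ≤ ∫ x, (H y * Real.exp (2 / a)) * Real.sinc x ^ 2 :=
            setIntegral_le_integral (integrable_sinc_sq.const_mul _)
              (ae_of_all _ fun x ↦ mul_nonneg (mul_nonneg (hH0 _) (Real.exp_nonneg _))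
                (sq_nonneg _))
        _ = _ := by rw [integral_const_mul, mul_assoc]
    · have hIJ : I - J a = ∫ x in (Icc (-a) a)ᶜ, Real.sinc x ^ 2 := by
        rw [hI, ← integral_add_compl (measurableSet_Icc (a := -a) (b := a)) integrable_sinc_sq]
        simp [J]
      rw [hIJ, ← integral_const_mul]
      refine setIntegral_mono (hint _ _).integrableOn
        (integrable_sinc_sq.const_mul _).integrableOn fun x ↦ ?_
      exact mul_le_mul_of_nonneg_right (hHC _) (sq_nonneg _)
  have h2a : Tendsto (fun a : ℝ ↦ 2 / a) atTop (𝓝 0) := tendsto_const_nhds.div_atTop tendsto_id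
  -- As `a → ∞` the bounds `hup` and `hlow` become `I * H y ≤ I` and `I ≤ H y * I` in the limit, so
  -- for `l < 1 < r` some finite `a` already gives `l < H y < r` for large `y`.
  refine tendsto_order.mpr ⟨fun l hl ↦ ?_, fun r hr ↦ ?_⟩
  · have ht : Tendsto (fun a ↦ l * (Real.exp (2 / a) * I) + C * (I - J a)) atTop
        (𝓝 (l * (Real.exp 0 * I) + C * (I - I))) :=
      (((Real.continuous_exp.tendsto 0).comp h2a).mul_const I |>.const_mul l).add
        ((hJ.const_sub I).const_mul C)
    have hlt : l * (Real.exp 0 * I) + C * (I - I) < I := by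
      rw [Real.exp_zero]
      nlinarith
    obtain ⟨a, ha, ha0⟩ := ((ht.eventually_lt_const hlt).and (eventually_gt_atTop 0)).exists
    have hy := (hlim _ (show 0 < (a ^ 2)⁻¹ by positivity)).comp
      (tendsto_atTop_add_const_right atTop (-(1 / a)) tendsto_id)
    filter_upwards [hy.eventually_const_lt ha] with y hy
    have hy' := hy.trans_le (hlow ha0 y)
    exact lt_of_mul_lt_mul_right (by linarith) (by positivity : 0 ≤ Real.exp (2 / a) * I)
  · have ht : Tendsto (fun a ↦ Real.exp (-(2 / a)) * J a * r) atTop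
        (𝓝 (Real.exp (-0) * I * r)) :=
      (((Real.continuous_exp.tendsto (-0)).comp h2a.neg).mul hJ).mul_const r
    have hlt : I < Real.exp (-0) * I * r := by
      rw [neg_zero, Real.exp_zero]
      nlinarith
    obtain ⟨a, ha, ha0⟩ := ((ht.eventually_const_lt hlt).and (eventually_gt_atTop 0)).exists
    have hy := (hlim _ (show 0 < (a ^ 2)⁻¹ by positivity)).comp
      (tendsto_atTop_add_const_right atTop (1 / a) tendsto_id)
    filter_upwards [hy.eventually_lt_const ha] with y hy
    have hJ0 : 0 ≤ J a := integral_nonneg fun x ↦ sq_nonneg _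
    exact lt_of_mul_lt_mul_left ((hup ha0 y).trans_lt hy) (by positivity)

/-- A Tauberian theorem of Wiener–Ikehara type, for `H` already known to be bounded: if the Laplace
transform of `H - 1` extends continuously to `0 ≤ re s`, then `H` tends to `1`. -/
theorem tendsto_one_of_laplace {H : ℝ → ℝ} {C : ℝ} (hHm : Measurable H)
    (hH0 : ∀ u, 0 ≤ H u) (hHC : ∀ u, H u ≤ C) (hHneg : ∀ u ≤ 0, H u = 0)
    (hmono : ∀ u v, u ≤ v → H u ≤ H v * Real.exp (v - u))
    {G : ℂ → ℂ} (hGc : ContinuousOn G {s | 0 ≤ s.re})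
    (hG : ∀ s : ℂ, 0 < s.re →
      ∫ u in Ioi (0 : ℝ), ((H u - 1 : ℝ) : ℂ) * Complex.exp (-s * u) = G s) :
    Tendsto H atTop (𝓝 1) := by
  have hC : 0 ≤ C := (hH0 0).trans (hHC 0)
  refine tendsto_of_tendsto_integral_mul_sinc_sq hHm hH0 hHC hmono fun b hb ↦ ?_
  have hBm : Measurable fun u ↦ H u - 1 := hHm.sub_const 1
  have hBC (u : ℝ) : |H u - 1| ≤ C + 1 :=
    abs_le.mpr ⟨by linarith [hH0 u], by linarith [hHC u]⟩
  -- The Laplace transform sees only `u > 0`, where `H = (H - 1) + 1`; the means of `H - 1` tend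
  -- to `0`, those of `1` to the full mass of the kernel.
  have h1 := tendsto_integral_mul_fejer hBm hBC hGc hG (show 0 < 2 / b by positivity)
  have h1' : Tendsto (fun y ↦ ∫ x, (Ioi 0).indicator (fun u ↦ H u - 1) (y - b * x) *
      Real.sinc x ^ 2) atTop (𝓝 0) := by
    have := h1.const_mul (b / 4)
    rw [mul_zero] at this
    refine this.congr fun y ↦ ?_
    rw [← integral_indicator measurableSet_Ioi]
    have e := integral_mul_fejer_eq ((Ioi 0).indicator fun u ↦ H u - 1) hb y
    simp_rw [indicator_mul_left, e]
    field_simp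
  have h2 : Tendsto (fun y ↦ ∫ x, (Ioi (0 : ℝ)).indicator 1 (y - b * x) * Real.sinc x ^ 2) atTop
      (𝓝 (∫ x, Real.sinc x ^ 2)) := by
    refine tendsto_integral_filter_of_dominated_convergence _ ?_ ?_ integrable_sinc_sq ?_
    · refine Eventually.of_forall fun y ↦ Measurable.aestronglyMeasurable ?_
      have := Real.continuous_sinc.measurable
      have : Measurable ((Ioi (0 : ℝ)).indicator (1 : ℝ → ℝ)) :=
        measurable_one.indicator measurableSet_Ioi
      fun_prop
    · refine Eventually.of_forall fun y ↦ ae_of_all _ fun x ↦ ?_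
      rw [norm_mul, Real.norm_of_nonneg (sq_nonneg (Real.sinc x))]
      refine mul_le_of_le_one_left (sq_nonneg _) ?_
      exact (norm_indicator_le_norm_self _ _).trans (by simp)
    · refine ae_of_all _ fun x ↦ tendsto_const_nhds.congr' ?_
      filter_upwards [eventually_gt_atTop (b * x)] with y hy
      rw [indicator_of_mem (mem_Ioi.mpr (sub_pos.mpr hy)), Pi.one_apply, one_mul]
  have h := h1'.add h2
  rw [zero_add] at h
  refine h.congr fun y ↦ ?_
  have hm (f : ℝ → ℝ) (hf : Measurable f) (K : ℝ) (hK : ∀ u, |f u| ≤ K) :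
      Integrable fun x ↦ (Ioi (0 : ℝ)).indicator f (y - b * x) * Real.sinc x ^ 2 :=
    integrable_comp_mul_sinc_sq (hf.indicator measurableSet_Ioi)
      (fun u ↦ (norm_indicator_le_norm_self f u).trans (hK u)) y b
  rw [← integral_add (hm _ hBm _ hBC) (hm 1 measurable_one 1 (by simp))]
  refine integral_congr_ae (ae_of_all _ fun x ↦ ?_)
  simp only
  by_cases hx : 0 < y - b * x
  · rw [indicator_of_mem (mem_Ioi.mpr hx), indicator_of_mem (mem_Ioi.mpr hx), Pi.one_apply]
    ring
  · rw [indicator_of_notMem (by simpa using hx), indicator_of_notMem (by simpa using hx),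
      hHneg _ (not_lt.mp hx)]
    ring

/-! ### Asymptotics of the Chebyshev functions -/

open ArithmeticFunction (vonMangoldt vonMangoldt_nonneg)
open ArithmeticFunction.vonMangoldt (LFunctionResidueClassAux continuousOn_LFunctionResidueClassAux
  eqOn_LFunctionResidueClassAux residueClass)

/-- The L-series of `Λ` is a function continuous on `1 ≤ re s` plus the principal part at `s = 1`;
the residue class modulo `1` is all of `ℕ`. -/
lemma LSeries_vonMangoldt_eq_add_inv {s : ℂ} (hs : 1 < s.re) :
    LSeries (fun n ↦ (vonMangoldt n : ℂ)) s =
      LFunctionResidueClassAux (1 : ZMod 1) s + (s - 1)⁻¹ := by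
  have h := eqOn_LFunctionResidueClassAux (a := (1 : ZMod 1)) isUnit_one hs
  have hr (n : ℕ) : residueClass (1 : ZMod 1) n = vonMangoldt n :=
    indicator_of_mem (s := {n : ℕ | (n : ZMod 1) = 1}) (Subsingleton.elim (n : ZMod 1) 1) _
  simp only [hr] at h
  rw [h]
  simp

/-- Partial summation, with the substitution `x = e^u`: `L(Λ, s + 1) / (s + 1)` is the Laplace
transform of `ψ(e^u) e^{-u}`. -/
lemma LSeries_vonMangoldt_eq_integral_psi {s : ℂ} (hs : 0 < s.re) :
    LSeries (fun n ↦ (vonMangoldt n : ℂ)) (s + 1) = (s + 1) *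
      ∫ u in Ioi (0 : ℝ), ((Chebyshev.psi (Real.exp u) * Real.exp (-u) : ℝ) : ℂ) *
        Complex.exp (-s * u) := by
  have hsum (x : ℝ) : ∑ k ∈ Finset.Icc 1 ⌊x⌋₊, vonMangoldt k = Chebyshev.psi x := rfl
  have hO : (fun n : ℕ ↦ ∑ k ∈ Finset.Icc 1 n, vonMangoldt k) =O[atTop]
      fun n ↦ (n : ℝ) ^ (1 : ℝ) := by
    refine IsBigO.of_bound (Real.log 4 + 4) (Eventually.of_forall fun n ↦ ?_)
    have h := hsum n
    rw [Nat.floor_natCast] at h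
    rw [h, Real.rpow_one, Real.norm_of_nonneg (Chebyshev.psi_nonneg _),
      Real.norm_of_nonneg n.cast_nonneg]
    exact Chebyshev.psi_le_const_mul_self n.cast_nonneg
  rw [LSeries_eq_mul_integral_of_nonneg vonMangoldt zero_le_one (by simpa using hs) hO
    fun _ ↦ vonMangoldt_nonneg]
  congr 1
  have h := integral_comp_exp_Ioi
    (fun t : ℝ ↦ (∑ k ∈ Finset.Icc 1 ⌊t⌋₊, (vonMangoldt k : ℂ)) * (t : ℂ) ^ (-(s + 1 + 1))) 0
  rw [Real.exp_zero] at h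
  rw [← h]
  refine integral_congr_ae (ae_of_all _ fun u ↦ ?_)
  simp only
  rw [← Complex.ofReal_sum, hsum, Complex.real_smul, Complex.cpow_def_of_ne_zero
    (Complex.ofReal_ne_zero.mpr (Real.exp_ne_zero u)), ← Complex.ofReal_log (Real.exp_nonneg u),
    Real.log_exp]
  push_cast
  have : Complex.exp u * Complex.exp (u * -(s + 1 + 1)) =
      Complex.exp (-u) * Complex.exp (-s * u) := by
    rw [← Complex.exp_add, ← Complex.exp_add]
    ring_nf
  linear_combination (Chebyshev.psi (Real.exp u) : ℂ) * this

lemma tendsto_psi_exp :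
    Tendsto (fun u ↦ Chebyshev.psi (Real.exp u) * Real.exp (-u)) atTop (𝓝 1) := by
  have hm : Measurable fun u ↦ Chebyshev.psi (Real.exp u) * Real.exp (-u) := by
    have := Chebyshev.psi_mono.measurable
    fun_prop
  have h0 (u : ℝ) : 0 ≤ Chebyshev.psi (Real.exp u) * Real.exp (-u) :=
    mul_nonneg (Chebyshev.psi_nonneg _) (Real.exp_nonneg _)
  have hC (u : ℝ) : Chebyshev.psi (Real.exp u) * Real.exp (-u) ≤ Real.log 4 + 4 := by
    rw [Real.exp_neg, ← div_eq_mul_inv, div_le_iff₀ (Real.exp_pos u)]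
    exact Chebyshev.psi_le_const_mul_self (Real.exp_nonneg u)
  -- If `A` is `L(Λ, ·)` without its principal part at `1`, then
  -- `(A (s + 1) + 1 / s) / (s + 1) - 1 / s = (A (s + 1) - 1) / (s + 1)`.
  refine tendsto_one_of_laplace (G := fun s ↦
    (LFunctionResidueClassAux (1 : ZMod 1) (s + 1) - 1) / (s + 1)) hm h0 hC ?_ ?_ ?_ ?_
  · intro u hu
    rw [Chebyshev.psi_eq_zero_of_le_one (Real.exp_le_one_iff.mpr hu), zero_mul]
  · intro u v huv
    rw [mul_assoc, ← Real.exp_add, show -v + (v - u) = -u by ring]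
    exact mul_le_mul_of_nonneg_right (Chebyshev.psi_mono (Real.exp_le_exp.mpr huv))
      (Real.exp_nonneg _)
  · refine ContinuousOn.div ?_ (by fun_prop) fun s (hs : 0 ≤ s.re) h ↦ ?_
    · refine ContinuousOn.sub ?_ continuousOn_const
      exact (continuousOn_LFunctionResidueClassAux 1).comp (by fun_prop)
        fun s (hs : 0 ≤ s.re) ↦ by simpa using hs
    · have := congrArg Complex.re h
      simp at this
      linarith
  · intro s hs
    have hs0 : s ≠ 0 := fun h ↦ by simp [h] at hs
    have hs1 : s + 1 ≠ 0 := fun h ↦ by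
      have := congrArg Complex.re h
      simp at this
      linarith
    have hexp : IntegrableOn (fun u : ℝ ↦ Complex.exp (-s * u)) (Ioi 0) :=
      integrableOn_exp_mul_complex_Ioi (by simpa using hs) 0
    have hHexp : IntegrableOn (fun u : ℝ ↦
        ((Chebyshev.psi (Real.exp u) * Real.exp (-u) : ℝ) : ℂ) * Complex.exp (-s * u)) (Ioi 0) := by
      refine hexp.bdd_mul (c := Real.log 4 + 4)
        (Complex.measurable_ofReal.comp hm).aestronglyMeasurable (ae_of_all _ fun u ↦ ?_)
      rw [Complex.norm_real, Real.norm_of_nonneg (h0 u)]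
      exact hC u
    have h1 := LSeries_vonMangoldt_eq_integral_psi hs
    rw [LSeries_vonMangoldt_eq_add_inv (by simpa using hs), add_sub_cancel_right] at h1
    have h2 := integral_exp_mul_complex_Ioi (a := -s) (by simpa using hs) 0
    simp only [Complex.ofReal_sub, Complex.ofReal_one, sub_mul, one_mul]
    rw [integral_sub hHexp hexp, h2]
    rw [eq_div_iff hs1, sub_mul, mul_comm _ (s + 1), ← h1]
    simp
    field_simp
    ring

theorem isEquivalent_psi : Chebyshev.psi ~[atTop] id := by
  refine (isEquivalent_iff_tendsto_one ((eventually_ne_atTop 0).mono fun x hx ↦ hx)).mpr ?_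
  refine (tendsto_psi_exp.comp Real.tendsto_log_atTop).congr' ?_
  filter_upwards [eventually_gt_atTop 0] with x hx
  simp only [Function.comp_apply, Pi.div_apply]
  rw [Real.exp_neg, Real.exp_log hx, div_eq_mul_inv]

theorem isEquivalent_theta : Chebyshev.theta ~[atTop] id := by
  have h : (Chebyshev.psi - Chebyshev.theta) =o[atTop] (id : ℝ → ℝ) :=
    Chebyshev.isBigO_psi_sub_theta_sqrt.trans_isLittleO <| by
      refine isLittleO_of_tendsto' ((eventually_ne_atTop 0).mono fun x hx h ↦ (hx h).elim) ?_
      exact Real.tendsto_sqrt_atTop.inv_tendsto_atTop.congr fun x ↦ Real.sqrt_div_self.symm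
  have := isEquivalent_psi.sub_isLittleO h
  rwa [sub_sub_cancel] at this

/-! ### The prime counting function and the `n`-th prime -/

theorem isEquivalent_primeCounting :
    (fun x : ℝ ↦ (Nat.primeCounting ⌊x⌋₊ : ℝ)) ~[atTop] fun x : ℝ ↦ x / Real.log x := by
  have h1 : (fun x ↦ Chebyshev.theta x / Real.log x) ~[atTop] fun x ↦ x / Real.log x :=
    isEquivalent_theta.div IsEquivalent.refl
  have h2 : (fun x : ℝ ↦ x / Real.log x ^ 2) =o[atTop] fun x ↦ x / Real.log x := by
    have h : (fun x : ℝ ↦ (Real.log x)⁻¹) =o[atTop] fun _ ↦ (1 : ℝ) :=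
      (isLittleO_one_iff ℝ).mpr Real.tendsto_log_atTop.inv_tendsto_atTop
    refine ((isBigO_refl (fun x : ℝ ↦ x / Real.log x) atTop).mul_isLittleO h).congr
      (fun x ↦ ?_) fun x ↦ mul_one _
    ring
  refine (h1.add_isLittleO (Chebyshev.primeCounting_sub_theta_div_log_isBigO.trans_isLittleO
    h2)).congr_left (Eventually.of_forall fun x ↦ ?_)
  simp

/-- If `f ~ g / log g` then `log f = log g - log log g + o(1) ~ log g`. -/
lemma isEquivalent_log_of_isEquivalent_div_log {α : Type*} {l : Filter α} {f g : α → ℝ}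
    (hg : Tendsto g l atTop) (h : f ~[l] fun x ↦ g x / Real.log (g x)) :
    (fun x ↦ Real.log (f x)) ~[l] fun x ↦ Real.log (g x) := by
  have hlog := Real.tendsto_log_atTop.comp hg
  have hlim : Tendsto (fun x ↦ f x / (g x / Real.log (g x))) l (𝓝 1) := by
    refine (isEquivalent_iff_tendsto_one ?_).mp h
    filter_upwards [hg.eventually_gt_atTop 0, hlog.eventually_gt_atTop 0] with x h1 h2
    exact (div_pos h1 h2).ne'
  have hO : (fun x ↦ Real.log (f x / (g x / Real.log (g x)))) =o[l] fun x ↦ Real.log (g x) := by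
    refine IsBigO.trans_isLittleO ((hlim.log one_ne_zero).isBigO_one ℝ) ?_
    exact (isLittleO_const_left.mpr (Or.inr (tendsto_norm_atTop_atTop.comp hlog)))
  have hlo : (fun x ↦ Real.log (Real.log (g x))) =o[l] fun x ↦ Real.log (g x) :=
    Real.isLittleO_log_id_atTop.comp_tendsto hlog
  refine ((IsEquivalent.refl (u := fun x ↦ Real.log (g x))).add_isLittleO
    (hO.sub hlo)).congr_left ?_
  filter_upwards [hg.eventually_gt_atTop 0, hlog.eventually_gt_atTop 0,
    hlim.eventually_const_lt one_pos] with x h1 h2 h3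
  have h4 : f x ≠ 0 := fun h ↦ by simp [h] at h3
  simp only [Function.comp_apply] at h2
  simp only [Pi.add_apply]
  rw [Real.log_div h4 (div_pos h1 h2).ne', Real.log_div h1.ne' h2.ne']
  ring

theorem isEquivalent_nth_prime :
    (fun n : ℕ ↦ (Nat.nth Nat.Prime (n - 1) : ℝ)) ~[atTop]
      fun n : ℕ ↦ (n : ℝ) * Real.log (n : ℝ) := by
  have hp : Tendsto (fun n : ℕ ↦ (Nat.nth Nat.Prime (n - 1) : ℝ)) atTop atTop :=
    tendsto_natCast_atTop_atTop.comp
      ((Nat.nth_strictMono Nat.infinite_setOfPred_prime).tendsto_atTop.comp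
        (tendsto_sub_atTop_nat 1))
  -- The prime of index `n - 1`, counting from `0`, is the `n`-th prime `p`, so `π p = n`.
  have hn : (fun n : ℕ ↦ (n : ℝ)) ~[atTop] fun n : ℕ ↦ (Nat.nth Nat.Prime (n - 1) : ℝ) /
      Real.log (Nat.nth Nat.Prime (n - 1) : ℝ) := by
    refine (isEquivalent_primeCounting.comp_tendsto hp).congr_left ?_
    filter_upwards [eventually_ge_atTop 1] with n hn
    simp only [Function.comp_apply, Nat.floor_natCast]
    rw [Nat.primeCounting, Nat.primeCounting', Nat.count_nth_succ_of_infinite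
      Nat.infinite_setOfPred_prime, Nat.sub_add_cancel hn]
  refine ((hn.mul (isEquivalent_log_of_isEquivalent_div_log hp hn)).congr_right ?_).symm
  filter_upwards [(Real.tendsto_log_atTop.comp hp).eventually_gt_atTop 0] with n hn
  exact div_mul_cancel₀ _ hn.ne'

end PrimeNumberTheorem

theorem mainTheorem2 :
    ((fun x : ℝ => (Nat.primeCounting ⌊x⌋₊ : ℝ)) ~[atTop] fun x : ℝ => x / Real.log x) ∧
    ((fun n : ℕ => (Nat.nth Nat.Prime (n - 1) : ℝ)) ~[atTop]
      fun n : ℕ => (n : ℝ) * Real.log (n : ℝ)) :=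
  ⟨PrimeNumberTheorem.isEquivalent_primeCounting, PrimeNumberTheorem.isEquivalent_nth_prime⟩
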